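/- Let $\mathcal D(X)$ be the set of finitely supported probability distributions on a set $X$, let $\delta_x$ be the Dirac distribution, and let $cc$ denote convex closure. Let $\mathcal C(X)$ be the set of nonempty finitely generated convex subsets of $\mathcal D(X)$; it is a functor by direct image under pushforward. Write $1=\{\star\}$. A set $S\in\mathcal C(X+1)$ is $\bot$-closed if, with $\varphi$, it contains every $\psi\in\mathcal D(X+1)$ such that $\psi(x)\le\varphi(x)$ for all $x\in X$. Let $\mathcal C^{\downarrow}(X)\subseteq\mathcal C(X+1)$ be the subset of $\bot$-closed sets. Consider the signature with a constant $\star$, a binary operation $\oplus$ and binary operations $+_p$ for $p\in(0,1)$. The theory $\mathrm{ET}_{CS}^{\star}$ has the axioms $$x\oplus(y\oplus z)=(x\oplus y)\oplus z,\quad x\oplus y=y\oplus x,\quad x\oplus x=x,$$ $$(x+_q y)+_p z=x+_{pq}(y+_{\frac{p(1-q)}{1-pq}}z),\quad x+_p y=y+_{1-p}x,\quad x+_p x=x,$$ $$x+_p(y\oplus z)=(x+_p y)\oplus(x+_p z)$$ for all $p,q\in(0,1)$. The theory $\mathrm{ET}_{CS}^{\bot}$ adds $x\oplus\star=x$, and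 $\mathrm{ET}_{CS}^{\bot,BH}$ adds both $x\oplus\star=x$ and $x+_p\star=\star$ for all $p\in(0,1)$. To these theories correspond monads $M$ as follows. * $\mathrm{ET}_{CS}^{\star}$ corresponds to $M=\mathcal C(\cdot+1)$, with unit $x\mapsto\{\delta_x\}$. The operations on $M(X)$ are convex union $S\oplus T=cc(S\cup T)$, weighted Minkowski sum $S+_pT=\{p\varphi+(1-p)\psi\mid\varphi\in S,\psi\in T\}$, and $\star=\{\delta_\star\}$. * $\mathrm{ET}_{CS}^{\bot,BH}$ corresponds to $M=\mathcal C+1$, with unit $x\mapsto\{\delta_x\}$. The operations are convex union and weighted Minkowski sum on $\mathcal C(X)$; the added element $\star$ is neutral for $\oplus$ and absorbing for every $+_p$. * $\mathrm{ET}_{CS}^{\bot}$ corresponds to $M=\mathcal C^{\downarrow}$, with unit $x\mapsto cc\{\delta_x,\delta_\star\}$ and the operations inherited from $\mathcal C(X+1)$. For each such $\mathtt{Th}$ and $M$, let $\sigma_X$ be the homomorphism from terms over $X$ modulo $\mathtt{Th}$ to $M(X)$ that extends the unit. Let $A$ be a set of actions. The set $Proc$ of process terms is given by $$P::=\mathbf{nil}\mid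 a.P\mid P\mathbin{\overline\oplus}P\mid P\mathbin{\overline{+}_p}P\qquad(a\in A,\ p\in(0,1)).$$ The transition function $\tau$ from $Proc$ to terms over $Proc$ is defined by $$\tau(\mathbf{nil})=\star,\quad \tau(a.P)=P,\quad \tau(P\mathbin{\overline\oplus}Q)=\tau(P)\oplus\tau(Q),\quad \tau(P\mathbin{\overline{+}_p}Q)=\tau(P)+_p\tau(Q).$$ Actions are not recorded by $\tau$, so with one action this is the unlabelled language. Process terms form an $M$-coalgebra via $\tau_M(P)=\sigma_{Proc}([\tau(P)]_{/\mathtt{Th}})$. * *Proof system.* Let $\overset{\mathtt{Th}}{\sim}$ be the smallest relation on $Proc$ closed under the following rule: if all pairs in a relation $R$ have been derived, and $\tau(P)=\tau(Q)$ is derivable in equational logic from the axioms of $\mathtt{Th}$ and the equations $P'=Q'$ for $(P',Q')\in R$ (elements of $Proc$ are treated as constants), then $P\overset{\mathtt{Th}}{\sim}Q$. * *Behavioural equivalence.* An equivalence relation $R$ on $Proc$, with quotient map $q_R:Proc\to Proc/R$, is a behavioural equivalence for $M$ if $M(q_R)(\tau_M(P))=M(q_R)(\tau_M(Q))$ whenever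 $P\mathrel R Q$. Write $P\simeq_M Q$ if some behavioural equivalence for $M$ relates $P$ and $Q$. **Theorem.** For each pair $(\mathtt{Th},M)$ among $(\mathrm{ET}_{CS}^{\star},\mathcal C(\cdot+1))$, $(\mathrm{ET}_{CS}^{\bot,BH},\mathcal C+1)$ and $(\mathrm{ET}_{CS}^{\bot},\mathcal C^{\downarrow})$, and for all $P,Q\in Proc$, $$P\overset{\mathtt{Th}}{\sim}Q\iff P\simeq_M Q .$$ -/

import Mathlib

open CategoryTheory Convexity

universe u v

namespace NDProb

/-! ### Terms, equational theories, equational logic -/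

/-- Probabilities in the open interval `(0,1)`. -/
abbrev Prob : Type := Set.Ioo (0 : ℝ) 1

/-- `1 - p` -/
def Prob.compl (p : Prob) : Prob :=
  ⟨1 - p.1, by have := p.2.2; linarith, by have := p.2.1; linarith⟩

/-- `p * q` -/
def Prob.mul (p q : Prob) : Prob :=
  ⟨p.1 * q.1, mul_pos p.2.1 q.2.1, by have := p.2; have := q.2; nlinarith [p.2.1, q.2.2, p.2.2]⟩

/-- `p * (1 - q) / (1 - p * q)` -/
noncomputable def Prob.skew (p q : Prob) : Prob :=
  ⟨p.1 * (1 - q.1) / (1 - p.1 * q.1), by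
    have h1 := (Prob.mul p q).2.2
    have h2 := mul_pos p.2.1 (Prob.compl q).2.1
    simp only [Prob.mul, Prob.compl] at h1 h2
    refine ⟨div_pos h2 (by linarith), ?_⟩
    rw [div_lt_one (by linarith)]
    nlinarith [p.2.2]⟩

/-- Terms over the signature with a constant `⋆`, a binary operation `⊕`
and binary operations `+_p` for `p ∈ (0,1)`, with generators in `X`. -/
inductive Term (X : Type u) : Type u
  | var (x : X) : Term X
  | star : Term X
  | oplus (s t : Term X) : Term X
  | pplus (p : Prob) (s t : Term X) : Term X

/-- Simultaneous substitution of terms for generators. -/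
def Term.subst {X : Type u} {Y : Type v} (θ : X → Term Y) : Term X → Term Y
  | .var x => θ x
  | .star => .star
  | .oplus s t => .oplus (s.subst θ) (t.subst θ)
  | .pplus p s t => .pplus p (s.subst θ) (t.subst θ)

/-- A set of equations, between terms over the variables `0, 1, 2, …`. -/
abbrev Equations : Type := Set (Term ℕ × Term ℕ)

section Theories

open Term

/-- The axioms of (pointed) convex semilattices. -/
inductive CSAxiom : Term ℕ × Term ℕ → Prop
  | A : CSAxiom (oplus (var 0) (oplus (var 1) (var 2)), oplus (oplus (var 0) (var 1)) (var 2))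
  | C : CSAxiom (oplus (var 0) (var 1), oplus (var 1) (var 0))
  | I : CSAxiom (oplus (var 0) (var 0), var 0)
  | Ap (p q : Prob) : CSAxiom (pplus p (pplus q (var 0) (var 1)) (var 2),
      pplus (p.mul q) (var 0) (pplus (p.skew q) (var 1) (var 2)))
  | Cp (p : Prob) : CSAxiom (pplus p (var 0) (var 1), pplus p.compl (var 1) (var 0))
  | Ip (p : Prob) : CSAxiom (pplus p (var 0) (var 0), var 0)
  | D (p : Prob) : CSAxiom (pplus p (var 0) (oplus (var 1) (var 2)),
      oplus (pplus p (var 0) (var 1)) (pplus p (var 0) (var 2)))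

/-- The theory of pointed convex semilattices. -/
def pointedCS : Equations := {e | CSAxiom e}

/-- The bottom axiom `x ⊕ ⋆ = x`. -/
def bottomEq : Equations := {(oplus (var 0) star, var 0)}

/-- The black-hole axioms `x +_p ⋆ = ⋆`. -/
def blackHoleEq : Equations := Set.range fun p : Prob => (pplus p (var 0) star, star)

/-- The theory of convex semilattices with bottom. -/
def bottomCS : Equations := pointedCS ∪ bottomEq

/-- The theory of convex semilattices with bottom and black hole. -/
def bottomBlackHoleCS : Equations := pointedCS ∪ bottomEq ∪ blackHoleEq

end Theories

/-- Derivability in equational logic of an equation between terms over the generators `X`, from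
the equations of `E`, whose variables may be instantiated by arbitrary terms, together with the
equations `x = y` for `R x y`, in which the generators `x`, `y` are constants. -/
inductive Derivable (E : Equations) {X : Type u} (R : X → X → Prop) : Term X → Term X → Prop
  | ax {e : Term ℕ × Term ℕ} (he : e ∈ E) (θ : ℕ → Term X) :
      Derivable E R (e.1.subst θ) (e.2.subst θ)
  | hyp {x y : X} (h : R x y) : Derivable E R (.var x) (.var y)
  | refl (t : Term X) : Derivable E R t t
  | symm {s t : Term X} : Derivable E R s t → Derivable E R t s
  | trans {s t r : Term X} : Derivable E R s t → Derivable E R t r → Derivable E R s r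
  | oplus {s s' t t' : Term X} : Derivable E R s s' → Derivable E R t t' →
      Derivable E R (.oplus s t) (.oplus s' t')
  | pplus (p : Prob) {s s' t t' : Term X} : Derivable E R s s' → Derivable E R t t' →
      Derivable E R (.pplus p s t) (.pplus p s' t')

/-- Provable equality in the theory `E` of terms over `X`. -/
def termSetoid (E : Equations) (X : Type u) : Setoid (Term X) where
  r := Derivable E fun _ _ => False
  iseqv := ⟨.refl, .symm, .trans⟩

/-- Terms over `X` modulo provable equality in the theory `E`. -/
def TermMod (E : Equations) (X : Type u) : Type u := Quotient (termSetoid E X)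

/-- An algebra for the signature, with carrier `α`. -/
structure Alg (α : Type u) where
  star : α
  oplus : α → α → α
  pplus : Prob → α → α → α

/-- The interpretation of terms in an algebra. -/
def Term.eval {X : Type u} {α : Type v} (𝔸 : Alg α) (η : X → α) : Term X → α
  | .var x => η x
  | .star => 𝔸.star
  | .oplus s t => 𝔸.oplus (s.eval 𝔸 η) (t.eval 𝔸 η)
  | .pplus p s t => 𝔸.pplus p (s.eval 𝔸 η) (t.eval 𝔸 η)

/-- The algebra satisfies the equations of `E`. -/
def Alg.Models {α : Type v} (𝔸 : Alg α) (E : Equations) : Prop :=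
  ∀ e ∈ E, ∀ θ : ℕ → α, e.1.eval 𝔸 θ = e.2.eval 𝔸 θ

theorem Term.eval_subst {X : Type u} {Y : Type*} {α : Type v} (𝔸 : Alg α) (η : Y → α)
    (θ : X → Term Y) (t : Term X) :
    (t.subst θ).eval 𝔸 η = t.eval 𝔸 fun x => (θ x).eval 𝔸 η := by
  induction t with
  | var x => rfl
  | star => rfl
  | oplus s t hs ht => simp [Term.subst, Term.eval, hs, ht]
  | pplus p s t hs ht => simp [Term.subst, Term.eval, hs, ht]

theorem Derivable.eval_eq {E : Equations} {X : Type u} {R : X → X → Prop} {α : Type v}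
    {𝔸 : Alg α} (h : 𝔸.Models E) {η : X → α} (hη : ∀ x y, R x y → η x = η y) {s t : Term X}
    (d : Derivable E R s t) : s.eval 𝔸 η = t.eval 𝔸 η := by
  induction d with
  | ax he θ => rw [Term.eval_subst, Term.eval_subst]; exact h _ he _
  | hyp h => exact hη _ _ h
  | refl => rfl
  | symm _ ih => exact ih.symm
  | trans _ _ ih ih' => exact ih.trans ih'
  | oplus _ _ ih ih' => simp [Term.eval, ih, ih']
  | pplus p _ _ ih ih' => simp [Term.eval, ih, ih']

/-- The homomorphism from terms modulo `E` to a model of `E` that extends `η`. -/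
def TermMod.lift {E : Equations} {X : Type u} {α : Type v} {𝔸 : Alg α} (h : 𝔸.Models E)
    (η : X → α) : TermMod E X → α :=
  Quotient.lift (Term.eval 𝔸 η) fun _ _ d => Derivable.eval_eq h (fun _ _ h => h.elim) d

/-! ### Finitely generated convex sets of distributions

`StdSimplex ℝ X` is the set of finitely supported probability distributions on `X`. -/

/-- Nonempty finitely generated convex sets of finitely supported distributions on `X`. -/
@[ext]
structure ConvSet (X : Type u) : Type u where
  carrier : Set (StdSimplex ℝ X)
  nonempty : carrier.Nonempty
  finitelyGenerated : ∃ B : Set (StdSimplex ℝ X), B.Finite ∧ carrier = Convexity.convexHull ℝ B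

namespace ConvSet

variable {X : Type u} {Y : Type u}

theorem convex (S : ConvSet X) : IsConvexSet ℝ S.carrier := by
  obtain ⟨B, -, h⟩ := S.finitelyGenerated
  rw [h]
  exact .convexHull

/-- The convex closure `cc B` of a nonempty finite set `B` of distributions. -/
def cc (B : Set (StdSimplex ℝ X)) (hB : B.Finite) (hne : B.Nonempty) : ConvSet X where
  carrier := Convexity.convexHull ℝ B
  nonempty := hne.convexHull'
  finitelyGenerated := ⟨B, hB, rfl⟩

/-- `{δ_x}` -/
noncomputable def dirac (x : X) : ConvSet X where
  carrier := {StdSimplex.single x}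
  nonempty := Set.singleton_nonempty _
  finitelyGenerated := ⟨{StdSimplex.single x}, Set.finite_singleton _, by simp⟩

/-- Direct image under the pushforward of distributions along `f`. -/
noncomputable def map (f : X → Y) (S : ConvSet X) : ConvSet Y where
  carrier := StdSimplex.map f '' S.carrier
  nonempty := S.nonempty.image _
  finitelyGenerated := by
    obtain ⟨B, hB, h⟩ := S.finitelyGenerated
    exact ⟨_, hB.image _, by rw [h, (StdSimplex.isAffineMap_map ℝ f).image_convexHull]⟩

@[simp] theorem map_id (S : ConvSet X) : S.map id = S := by
  ext φ; simp [map]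

theorem map_map {Z : Type u} (f : X → Y) (g : Y → Z) (S : ConvSet X) :
    (S.map f).map g = S.map (g ∘ f) := by
  ext φ; simp [map, StdSimplex.map_comp]

/-- Convex union `cc (S ∪ T)`. -/
def union (S T : ConvSet X) : ConvSet X where
  carrier := Convexity.convexHull ℝ (S.carrier ∪ T.carrier)
  nonempty := (S.nonempty.inl).convexHull'
  finitelyGenerated := by
    obtain ⟨B, hB, h⟩ := S.finitelyGenerated
    obtain ⟨B', hB', h'⟩ := T.finitelyGenerated
    exact ⟨B ∪ B', hB.union hB', by simp [h, h']⟩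

/-- The distribution `p φ + (1 - p) ψ`. -/
noncomputable def mix (p : Prob) (φ ψ : StdSimplex ℝ X) : StdSimplex ℝ X :=
  convexCombPair p.1 (1 - p.1) p.2.1.le (sub_nonneg.2 p.2.2.le) (by ring) φ ψ

theorem isAffineMap_mix_right (p : Prob) (φ : StdSimplex ℝ X) : IsAffineMap ℝ (mix p φ) :=
  isAffineMap_convexCombPair _ _ _ _

theorem mix_comm (p : Prob) (φ ψ : StdSimplex ℝ X) : mix p φ ψ = mix p.compl ψ φ := by
  ext : 1
  simp [mix, Prob.compl, add_comm]

theorem isAffineMap_mix_left (p : Prob) (ψ : StdSimplex ℝ X) :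
    IsAffineMap ℝ (fun φ => mix p φ ψ) := by
  simp_rw [mix_comm p _ ψ]
  exact isAffineMap_mix_right _ _

/-- An affine image of a mixture. -/
theorem mix_map {F : StdSimplex ℝ X → StdSimplex ℝ Y} (hF : IsAffineMap ℝ F) (p : Prob)
    (φ ψ : StdSimplex ℝ X) : F (mix p φ ψ) = mix p (F φ) (F ψ) :=
  hF.map_convexCombPair _ _ _ _ _

theorem convex_image2_mix (p : Prob) {U V : Set (StdSimplex ℝ X)} (hU : IsConvexSet ℝ U)
    (hV : IsConvexSet ℝ V) : IsConvexSet ℝ (Set.image2 (mix p) U V) := by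
  refine IsConvexSet.of_convexCombPair_mem ?_
  rintro a b ha hb hab _ ⟨s, hs, t, ht, rfl⟩ _ ⟨s', hs', t', ht', rfl⟩
  refine ⟨_, hU.convexCombPair_mem hs hs' ha hb hab, _,
    hV.convexCombPair_mem ht ht' ha hb hab, ?_⟩
  ext : 1
  simp only [mix, StdSimplex.weights_convexCombPair]
  module

theorem image2_mix_convexHull (p : Prob) (U V : Set (StdSimplex ℝ X)) :
    Set.image2 (mix p) (Convexity.convexHull ℝ U) (Convexity.convexHull ℝ V) =
      Convexity.convexHull ℝ (Set.image2 (mix p) U V) := by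
  apply Set.Subset.antisymm
  · rintro _ ⟨s, hs, t, ht, rfl⟩
    have key : ∀ s ∈ U, ∀ t ∈ Convexity.convexHull ℝ V,
        mix p s t ∈ Convexity.convexHull ℝ (Set.image2 (mix p) U V) := fun s hs =>
      convexHull_min (C := mix p s ⁻¹' _)
        (fun t ht => subset_convexHull_self (Set.mem_image2_of_mem hs ht))
        (IsConvexSet.convexHull.preimage (isAffineMap_mix_right p s))
    exact convexHull_min (C := (fun s => mix p s t) ⁻¹' _) (fun s hs => key s hs t ht)
      (IsConvexSet.convexHull.preimage (isAffineMap_mix_left p t)) hs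
  · exact convexHull_min
      (Set.image2_subset subset_convexHull_self subset_convexHull_self)
      (convex_image2_mix p .convexHull .convexHull)

/-- Weighted Minkowski sum `{p φ + (1 - p) ψ | φ ∈ S, ψ ∈ T}`. -/
noncomputable def minkowski (p : Prob) (S T : ConvSet X) : ConvSet X where
  carrier := Set.image2 (mix p) S.carrier T.carrier
  nonempty := S.nonempty.image2 T.nonempty
  finitelyGenerated := by
    obtain ⟨B, hB, h⟩ := S.finitelyGenerated
    obtain ⟨B', hB', h'⟩ := T.finitelyGenerated
    exact ⟨_, hB.image2 _ hB', by rw [h, h', image2_mix_convexHull]⟩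

theorem union_assoc (S T U : ConvSet X) : S.union (T.union U) = (S.union T).union U := by
  apply ConvSet.ext
  simp [union, Set.union_assoc]

theorem union_comm (S T : ConvSet X) : S.union T = T.union S := by
  apply ConvSet.ext
  simp [union, Set.union_comm]

theorem union_self (S : ConvSet X) : S.union S = S := by
  apply ConvSet.ext
  simp [union, S.convex.convexHull_eq_self]

theorem minkowski_assoc (p q : Prob) (S T U : ConvSet X) :
    minkowski p (minkowski q S T) U = minkowski (p.mul q) S (minkowski (p.skew q) T U) := by
  apply ConvSet.ext
  refine Set.image2_assoc fun a b c => ?_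
  have h := (Prob.mul p q).2.2
  ext : 1
  simp only [mix, StdSimplex.weights_convexCombPair, Prob.mul, Prob.skew] at h ⊢
  have h' : 1 - p.1 * q.1 ≠ 0 := by linarith
  have h1 : (1 - p.1 * q.1) * (p.1 * (1 - q.1) / (1 - p.1 * q.1)) = p.1 * (1 - q.1) := by
    field_simp
  have h2 : (1 - p.1 * q.1) * (1 - p.1 * (1 - q.1) / (1 - p.1 * q.1)) = 1 - p.1 := by
    field_simp; ring
  simp only [smul_add, smul_smul, h1, h2, add_assoc]

theorem minkowski_comm (p : Prob) (S T : ConvSet X) :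
    minkowski p S T = minkowski p.compl T S := by
  apply ConvSet.ext
  refine (Set.image2_swap _ _ _).trans ?_
  simp only [minkowski, mix_comm p]

theorem minkowski_self (p : Prob) (S : ConvSet X) : minkowski p S S = S := by
  apply ConvSet.ext
  apply Set.Subset.antisymm
  · rintro _ ⟨s, hs, t, ht, rfl⟩
    exact S.convex.convexCombPair_mem hs ht _ _ _
  · exact fun s hs => ⟨s, hs, s, hs, convexCombPair_same _ _ _⟩

theorem minkowski_union (p : Prob) (S T U : ConvSet X) :
    minkowski p S (T.union U) = (minkowski p S T).union (minkowski p S U) := by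
  apply ConvSet.ext
  have := image2_mix_convexHull p S.carrier (T.carrier ∪ U.carrier)
  rw [S.convex.convexHull_eq_self, Set.image2_union_right] at this
  exact this

end ConvSet

/-! ### The functor `C(· + 1)`

The element `none : Option X` is the element `⋆` of `X + 1`. -/

/-- The functor `X ↦ C(X + 1)`. -/
noncomputable def convPlusOne : Type u ⥤ Type u where
  obj X := ConvSet (Option X)
  map f := ↾(ConvSet.map (Option.map f))
  map_id X := by
    refine ConcreteCategory.hom_ext _ _ fun S => ?_
    exact (congrArg (fun g => ConvSet.map g S) Option.map_id).trans (ConvSet.map_id S)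
  map_comp f g := by
    refine ConcreteCategory.hom_ext _ _ fun S => ?_
    exact (congrArg (fun h => ConvSet.map h S) (Option.map_comp_map f g).symm).trans
      (ConvSet.map_map _ _ S).symm

/-- The pointed convex semilattice `C(X + 1)`, which is free on `X`: convex union, weighted
Minkowski sum and `{δ_⋆}`. -/
noncomputable def convPlusOneAlg (X : Type u) : Alg (ConvSet (Option X)) where
  star := ConvSet.dirac none
  oplus := ConvSet.union
  pplus := ConvSet.minkowski

theorem convPlusOneAlg_models (X : Type u) : (convPlusOneAlg X).Models pointedCS := by
  rintro _ (_ | _ | _ | _ | _ | _ | _) θ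
  · exact ConvSet.union_assoc ..
  · exact ConvSet.union_comm ..
  · exact ConvSet.union_self ..
  · exact ConvSet.minkowski_assoc ..
  · exact ConvSet.minkowski_comm ..
  · exact ConvSet.minkowski_self ..
  · exact ConvSet.minkowski_union ..

/-- The unit `x ↦ {δ_x}`. -/
noncomputable def convPlusOneUnit {X : Type u} (x : X) : ConvSet (Option X) :=
  ConvSet.dirac (some x)

/-- The canonical isomorphism from terms modulo the theory of pointed convex semilattices to
`C(X + 1)`: the homomorphism that extends the unit. -/
noncomputable def convPlusOneSigma (X : Type u) : TermMod pointedCS X → ConvSet (Option X) :=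
  TermMod.lift (convPlusOneAlg_models X) convPlusOneUnit

/-! ### The functor `C + 1`

The element `none : Option (ConvSet X)` is the element `⋆` of `C(X) + 1`. -/

/-- The functor `X ↦ C(X) + 1`. -/
noncomputable def plusOneConv : Type u ⥤ Type u where
  obj X := Option (ConvSet X)
  map f := ↾(Option.map (ConvSet.map f))
  map_id X := by
    refine ConcreteCategory.hom_ext _ _ fun S => ?_
    cases S with
    | none => rfl
    | some S => exact congrArg some (ConvSet.map_id S)
  map_comp f g := by
    refine ConcreteCategory.hom_ext _ _ fun S => ?_
    cases S with
    | none => rfl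
    | some S => exact congrArg some (ConvSet.map_map f g S).symm

/-- `C(X) + 1` with convex union and weighted Minkowski sum, extended to the new element `⋆`
(the empty set of distributions), neutral for convex union and absorbing for all weighted
Minkowski sums. -/
noncomputable def plusOneConvAlg (X : Type u) : Alg (Option (ConvSet X)) where
  star := none
  oplus := fun S T => match S, T with
    | some S, some T => some (ConvSet.union S T)
    | some S, none => some S
    | none, T => T
  pplus := fun p S T => match S, T with
    | some S, some T => some (ConvSet.minkowski p S T)
    | _, _ => none

theorem plusOneConvAlg_models (X : Type u) :
    (plusOneConvAlg X).Models bottomBlackHoleCS := by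
  rintro e ((he | rfl) | ⟨p, rfl⟩) θ
  · rcases he with _ | _ | _ | _ | _ | _ | _
    · rcases h0 : θ 0 with _ | S <;> rcases h1 : θ 1 with _ | T <;> rcases h2 : θ 2 with _ | U <;>
        simp [Term.eval, plusOneConvAlg, h0, h1, h2, ConvSet.union_assoc]
    · rcases h0 : θ 0 with _ | S <;> rcases h1 : θ 1 with _ | T <;>
        simp [Term.eval, plusOneConvAlg, h0, h1, ConvSet.union_comm]
    · rcases h0 : θ 0 with _ | S <;>
        simp [Term.eval, plusOneConvAlg, h0, ConvSet.union_self]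
    · rcases h0 : θ 0 with _ | S <;> rcases h1 : θ 1 with _ | T <;> rcases h2 : θ 2 with _ | U <;>
        simp [Term.eval, plusOneConvAlg, h0, h1, h2, ConvSet.minkowski_assoc]
    · rcases h0 : θ 0 with _ | S <;> rcases h1 : θ 1 with _ | T <;>
        simp [Term.eval, plusOneConvAlg, h0, h1]
      exact ConvSet.minkowski_comm ..
    · rcases h0 : θ 0 with _ | S <;>
        simp [Term.eval, plusOneConvAlg, h0, ConvSet.minkowski_self]
    · rcases h0 : θ 0 with _ | S <;> rcases h1 : θ 1 with _ | T <;> rcases h2 : θ 2 with _ | U <;>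
        simp [Term.eval, plusOneConvAlg, h0, h1, h2, ConvSet.minkowski_union]
  · rcases h0 : θ 0 with _ | S <;> simp [Term.eval, plusOneConvAlg, h0]
  · rcases h0 : θ 0 with _ | S <;> simp [Term.eval, plusOneConvAlg, h0]

/-- The unit `x ↦ {δ_x}`. -/
noncomputable def plusOneConvUnit {X : Type u} (x : X) : Option (ConvSet X) :=
  some (ConvSet.dirac x)

/-- The canonical isomorphism from terms modulo the theory of convex semilattices with bottom and
black hole to `C(X) + 1`: the homomorphism that extends the unit. -/
noncomputable def plusOneConvSigma (X : Type u) :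
    TermMod bottomBlackHoleCS X → Option (ConvSet X) :=
  TermMod.lift (plusOneConvAlg_models X) plusOneConvUnit

/-! ### The functor `C^↓` of `⊥`-closed convex sets -/

/-- `⊥`-closedness: with `φ`, the set contains every distribution `ψ` on `X + 1` which is
pointwise below `φ` on `X`. -/
def IsBotClosed {X : Type u} (S : ConvSet (Option X)) : Prop :=
  ∀ φ ∈ S.carrier, ∀ ψ : StdSimplex ℝ (Option X),
    (∀ x : X, ψ.weights (some x) ≤ φ.weights (some x)) → ψ ∈ S.carrier

section Damp

variable {X Y : Type u}

/-- Keep `x` with probability `r x`, and move to `⋆` otherwise. -/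
noncomputable def dampPoint (r : X → Set.Icc (0 : ℝ) 1) : Option X → StdSimplex ℝ (Option X)
  | none => .single none
  | some x => .duple (some x) none (r x).2.1 (sub_nonneg.2 (r x).2.2) (by ring)

/-- Multiply the weight of each `x : X` by `r x`. -/
noncomputable def damp (r : X → Set.Icc (0 : ℝ) 1) (φ : StdSimplex ℝ (Option X)) :
    StdSimplex ℝ (Option X) :=
  φ.iConvexComb (dampPoint r)

theorem damp_weights (r : X → Set.Icc (0 : ℝ) 1) (φ : StdSimplex ℝ (Option X)) (x : X) :
    (damp r φ).weights (some x) = φ.weights (some x) * (r x).1 := by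
  classical
  rw [damp, StdSimplex.weights_iConvexComb, Finsupp.sum_apply, Finsupp.sum,
    Finset.sum_eq_single (some x)]
  · simp [dampPoint]
  · rintro (_ | y) - hy
    · simp [dampPoint]
    · have : y ≠ x := fun h => hy (by rw [h])
      simp [dampPoint, this]
  · intro h
    simp [Finsupp.notMem_support_iff.1 h]

theorem stdSimplex_option_ext {φ ψ : StdSimplex ℝ (Option X)}
    (h : ∀ x : X, φ.weights (some x) = ψ.weights (some x)) : φ = ψ := by
  classical
  have tot : ∀ χ : StdSimplex ℝ (Option X),
      χ.weights none + χ.weights.some.sum (fun _ r => r) = 1 := fun χ => by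
    rw [← χ.total, Finsupp.sum_option_index _ _ (by simp) (by simp)]
  have hs : φ.weights.some = ψ.weights.some := Finsupp.ext fun x => by simp [h]
  ext o
  cases o with
  | none => have h1 := tot φ; have h2 := tot ψ; rw [hs] at h1; linarith
  | some x => exact h x

theorem exists_damp {φ ψ : StdSimplex ℝ (Option X)}
    (h : ∀ x : X, ψ.weights (some x) ≤ φ.weights (some x)) :
    ∃ r : X → Set.Icc (0 : ℝ) 1, damp r φ = ψ := by
  refine ⟨fun x => ⟨ψ.weights (some x) / φ.weights (some x),
    div_nonneg (ψ.nonneg _) (φ.nonneg _), div_le_one_of_le₀ (h x) (φ.nonneg _)⟩, ?_⟩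
  refine stdSimplex_option_ext fun x => ?_
  rw [damp_weights]
  change φ.weights (some x) * (ψ.weights (some x) / φ.weights (some x)) = _
  by_cases h0 : φ.weights (some x) = 0
  · have := h x
    have h1 : 0 ≤ ψ.weights (some x) := ψ.nonneg _
    rw [h0] at this ⊢
    linarith
  · exact mul_div_cancel₀ _ h0

theorem isBotClosed_iff {S : ConvSet (Option X)} :
    IsBotClosed S ↔ ∀ r, ∀ φ ∈ S.carrier, damp r φ ∈ S.carrier := by
  constructor
  · intro h r φ hφ
    refine h φ hφ _ fun x => ?_
    rw [damp_weights]
    exact mul_le_of_le_one_right (φ.nonneg _) (r x).2.2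
  · intro h φ hφ ψ hψ
    obtain ⟨r, rfl⟩ := exists_damp hψ
    exact h r φ hφ

theorem isAffineMap_damp (r : X → Set.Icc (0 : ℝ) 1) : IsAffineMap ℝ (damp r) where
  map_sConvexComb s := by
    unfold damp
    rw [← iConvexComb_id, ← iConvexComb_assoc]
    rfl

end Damp

theorem IsBotClosed.map {X Y : Type u} (f : X → Y) {S : ConvSet (Option X)}
    (h : IsBotClosed S) : IsBotClosed (S.map (Option.map f)) := by
  rw [isBotClosed_iff] at h ⊢
  rintro r _ ⟨φ, hφ, rfl⟩
  refine ⟨_, h (r ∘ f) φ hφ, ?_⟩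
  rw [damp, damp, map_iConvexComb, iConvexComb_map]
  congr 1
  funext o
  cases o <;> simp [dampPoint]

theorem IsBotClosed.union {X : Type u} {S T : ConvSet (Option X)} (hS : IsBotClosed S)
    (hT : IsBotClosed T) : IsBotClosed (S.union T) := by
  rw [isBotClosed_iff] at hS hT ⊢
  intro r
  refine convexHull_min (C := damp r ⁻¹' _) ?_
    (IsConvexSet.convexHull.preimage (isAffineMap_damp r))
  rintro φ (hφ | hφ)
  · exact subset_convexHull_self (Or.inl (hS r φ hφ))
  · exact subset_convexHull_self (Or.inr (hT r φ hφ))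

theorem IsBotClosed.minkowski {X : Type u} (p : Prob) {S T : ConvSet (Option X)}
    (hS : IsBotClosed S) (hT : IsBotClosed T) : IsBotClosed (S.minkowski p T) := by
  rw [isBotClosed_iff] at hS hT ⊢
  rintro r _ ⟨φ, hφ, ψ, hψ, rfl⟩
  exact ⟨_, hS r φ hφ, _, hT r ψ hψ, (ConvSet.mix_map (isAffineMap_damp r) p φ ψ).symm⟩

theorem isBotClosed_dirac_none (X : Type u) : IsBotClosed (ConvSet.dirac (none : Option X)) := by
  rw [isBotClosed_iff]
  rintro r _ rfl
  simp [damp, dampPoint, ConvSet.dirac]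

/-- `cc {δ_x, δ_⋆}` -/
noncomputable def segment {X : Type u} (x : X) : ConvSet (Option X) :=
  ConvSet.cc {StdSimplex.single (some x), StdSimplex.single none} (Set.toFinite _)
    (Set.insert_nonempty _ _)

theorem isBotClosed_segment {X : Type u} (x : X) : IsBotClosed (segment x) := by
  rw [isBotClosed_iff]
  intro r
  refine convexHull_min (C := damp r ⁻¹' _) ?_
    (IsConvexSet.convexHull.preimage (isAffineMap_damp r))
  have h1 : StdSimplex.single (some x) ∈ (segment x).carrier :=
    subset_convexHull_self (Or.inl rfl)
  have h2 : StdSimplex.single none ∈ (segment x).carrier :=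
    subset_convexHull_self (Or.inr rfl)
  rintro φ (rfl | rfl)
  · have := (segment x).convex.convexCombPair_mem h1 h2 (r x).2.1 (sub_nonneg.2 (r x).2.2)
      (by ring)
    have e : damp r (.single (some x)) = convexCombPair (r x).1 (1 - (r x).1) (r x).2.1
        (sub_nonneg.2 (r x).2.2) (by ring) (.single (some x)) (.single none) := by
      rw [damp, iConvexComb_single]
      ext : 1
      simp [dampPoint]
    exact Set.mem_preimage.2 (e ▸ this)
  · have e : damp r (.single none) = .single none := by
      rw [damp, iConvexComb_single]
      rfl
    exact Set.mem_preimage.2 (e.symm ▸ h2)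

/-- The functor `X ↦ C^↓(X)`. -/
noncomputable def convDown : Type u ⥤ Type u where
  obj X := {S : ConvSet (Option X) // IsBotClosed S}
  map f := ↾(fun S => ⟨S.1.map (Option.map f), S.2.map f⟩)
  map_id X := by
    refine ConcreteCategory.hom_ext _ _ fun S => Subtype.ext ?_
    exact (congrArg (fun g => ConvSet.map g S.1) Option.map_id).trans (ConvSet.map_id S.1)
  map_comp f g := by
    refine ConcreteCategory.hom_ext _ _ fun S => Subtype.ext ?_
    exact (congrArg (fun h => ConvSet.map h S.1) (Option.map_comp_map f g).symm).trans
      (ConvSet.map_map _ _ S.1).symm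

/-- `C^↓(X)` with convex union, weighted Minkowski sum and `{δ_⋆}`. -/
noncomputable def convDownAlg (X : Type u) : Alg {S : ConvSet (Option X) // IsBotClosed S} where
  star := ⟨ConvSet.dirac none, isBotClosed_dirac_none X⟩
  oplus S T := ⟨S.1.union T.1, S.2.union T.2⟩
  pplus p S T := ⟨S.1.minkowski p T.1, S.2.minkowski p T.2⟩

theorem convDownAlg_models (X : Type u) : (convDownAlg X).Models bottomCS := by
  rintro e (he | rfl) θ
  · rcases he with _ | _ | _ | _ | _ | _ | _
    · exact Subtype.ext (ConvSet.union_assoc ..)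
    · exact Subtype.ext (ConvSet.union_comm ..)
    · exact Subtype.ext (ConvSet.union_self ..)
    · exact Subtype.ext (ConvSet.minkowski_assoc ..)
    · exact Subtype.ext (ConvSet.minkowski_comm ..)
    · exact Subtype.ext (ConvSet.minkowski_self ..)
    · exact Subtype.ext (ConvSet.minkowski_union ..)
  · refine Subtype.ext (ConvSet.ext ?_)
    obtain ⟨φ, hφ⟩ := (θ 0).1.nonempty
    have h : StdSimplex.single none ∈ (θ 0).1.carrier :=
      (θ 0).2 φ hφ _ fun x => by simp
    have h' : (θ 0).1.carrier ∪ {StdSimplex.single none} = (θ 0).1.carrier :=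
      Set.union_eq_left.2 (Set.singleton_subset_iff.2 h)
    exact (congrArg (Convexity.convexHull ℝ) h').trans (θ 0).1.convex.convexHull_eq_self

/-- The unit `x ↦ cc {δ_x, δ_⋆}`. -/
noncomputable def convDownUnit {X : Type u} (x : X) :
    {S : ConvSet (Option X) // IsBotClosed S} :=
  ⟨segment x, isBotClosed_segment x⟩

/-- The canonical isomorphism from terms modulo the theory of convex semilattices with bottom to
`C^↓(X)`: the homomorphism that extends the unit. -/
noncomputable def convDownSigma (X : Type u) :
    TermMod bottomCS X → {S : ConvSet (Option X) // IsBotClosed S} :=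
  TermMod.lift (convDownAlg_models X) convDownUnit

/-! ### Processes, the proof system, behavioural equivalence -/

/-- Process terms `nil`, `a.P`, `P ⊕ Q`, `P +_p Q` with actions `a : A`. -/
inductive Proc (A : Type u) : Type u
  | nil : Proc A
  | act (a : A) (P : Proc A) : Proc A
  | oplus (P Q : Proc A) : Proc A
  | pplus (p : Prob) (P Q : Proc A) : Proc A

/-- The transition function: a process term steps to a term over process terms. -/
def Proc.step {A : Type u} : Proc A → Term (Proc A)
  | nil => .star
  | act _ P => .var P
  | oplus P Q => .oplus P.step Q.step
  | pplus p P Q => .pplus p P.step Q.step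

/-- The relation on process terms defined by the proof system of the theory `E`. It is the
smallest relation closed under the rule: if premises `R` have been proved, and `step P = step Q`
is derivable in equational logic from `E` and the equations `R`, then `P` and `Q` are related. -/
inductive ProvablyEq (E : Equations) {A : Type u} : Proc A → Proc A → Prop
  | rule (R : Proc A → Proc A → Prop) (hR : ∀ P Q, R P Q → ProvablyEq E P Q) {P Q : Proc A}
      (h : Derivable E R P.step Q.step) : ProvablyEq E P Q

/-- Process terms as a `C(· + 1)`-coalgebra. -/
noncomputable def procConvPlusOne (A : Type u) : Endofunctor.Coalgebra convPlusOne.{u} where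
  V := Proc A
  str := ↾fun P => convPlusOneSigma (Proc A) (Quotient.mk _ P.step)

/-- Process terms as a `(C + 1)`-coalgebra. -/
noncomputable def procPlusOneConv (A : Type u) : Endofunctor.Coalgebra plusOneConv.{u} where
  V := Proc A
  str := ↾fun P => plusOneConvSigma (Proc A) (Quotient.mk _ P.step)

/-- Process terms as a `C^↓`-coalgebra. -/
noncomputable def procConvDown (A : Type u) : Endofunctor.Coalgebra convDown.{u} where
  V := Proc A
  str := ↾fun P => convDownSigma (Proc A) (Quotient.mk _ P.step)

/-- An equivalence relation `R` on the states of a coalgebra is a behavioural equivalence if the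
transitions of related states are identified by the functor applied to the quotient map. -/
def IsBehaviouralEquivalence {F : Type u ⥤ Type u} (V : Endofunctor.Coalgebra F)
    (R : Setoid V.V) : Prop :=
  ∀ x y : V.V, R x y →
    F.map (↾(Quotient.mk R)) (V.str x) = F.map (↾(Quotient.mk R)) (V.str y)

/-- Two states are behaviourally equivalent if some behavioural equivalence relates them. -/
def BehaviourallyEquivalent {F : Type u ⥤ Type u} (V : Endofunctor.Coalgebra F)
    (x y : V.V) : Prop :=
  ∃ R : Setoid V.V, IsBehaviouralEquivalence V R ∧ R x y

end NDProb

/-!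
A theory `E` makes `X ↦ TermMod E X` a functor, and `Proc A` a coalgebra for it. For this coalgebra
the result holds for every `E`. Given a behavioural equivalence `R`, choose in each `R`-class a
process of minimal depth. Processes reached from `P` are less deep than `P`, and so are their
representatives; by induction on depth, each of them is provably equal to its representative.
Replacing them turns equality of transitions modulo `R` into a derivation from proved equations.

The functors `M` of the theorem are handled by transporting behavioural equivalence along
`σ : TermMod E ⟶ M`, for which it suffices that `σ` is natural and injective. A left inverse of `σ`
comes from the universal property of `M`: every map from `X` to a model of `E` extends to a
homomorphism from `M X`. In a convex semilattice, finitely supported distributions have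
barycentres, and a finitely generated convex set is sent to the join of the barycentres of its
elements, which is already the join of the barycentres of finitely many generators. Barycentres are
computed in the cone over the barycentric algebra, a commutative monoid in which mixtures are sums
of scaled points.
-/

namespace NDProb

/-! ### Terms modulo a theory -/

section EquationalLogic

variable {E : Equations} {X Y : Type u}

theorem Term.subst_var (t : Term X) : t.subst Term.var = t := by
  induction t with
  | var x => rfl
  | star => rfl
  | oplus s t hs ht => rw [Term.subst, hs, ht]
  | pplus p s t hs ht => rw [Term.subst, hs, ht]

theorem Term.subst_subst {V : Type*} (θ : V → Term X) (θ' : X → Term Y) (t : Term V) :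
    (t.subst θ).subst θ' = t.subst fun x => (θ x).subst θ' := by
  induction t with
  | var x => rfl
  | star => rfl
  | oplus s t hs ht => rw [Term.subst, Term.subst, hs, ht, Term.subst]
  | pplus p s t hs ht => rw [Term.subst, Term.subst, hs, ht, Term.subst]

/-- The set of generators that occur in a term. -/
def Term.vars : Term X → Set X
  | .var x => {x}
  | .star => ∅
  | .oplus s t => s.vars ∪ t.vars
  | .pplus _ s t => s.vars ∪ t.vars

theorem Derivable.subst {R : X → X → Prop} {R' : Y → Y → Prop} {θ : X → Term Y}
    (hθ : ∀ x y, R x y → Derivable E R' (θ x) (θ y)) {s t : Term X} (d : Derivable E R s t) :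
    Derivable E R' (s.subst θ) (t.subst θ) := by
  induction d with
  | ax he θ' =>
    rw [Term.subst_subst, Term.subst_subst]
    exact .ax he _
  | hyp h => exact hθ _ _ h
  | refl t => exact .refl _
  | symm _ ih => exact ih.symm
  | trans _ _ ih ih' => exact ih.trans ih'
  | oplus _ _ ih ih' => exact .oplus ih ih'
  | pplus p _ _ ih ih' => exact .pplus p ih ih'

theorem Derivable.mono {R R' : X → X → Prop} (h : ∀ x y, R x y → R' x y) {s t : Term X}
    (d : Derivable E R s t) : Derivable E R' s t := by
  simpa only [Term.subst_var] using d.subst fun x y hxy => .hyp (h x y hxy)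

theorem Derivable.subst_congr {R : Y → Y → Prop} {θ θ' : X → Term Y} {t : Term X}
    (h : ∀ x ∈ t.vars, Derivable E R (θ x) (θ' x)) :
    Derivable E R (t.subst θ) (t.subst θ') := by
  induction t with
  | var x => exact h x rfl
  | star => exact .refl _
  | oplus s t hs ht =>
    exact .oplus (hs fun x hx => h x (.inl hx)) (ht fun x hx => h x (.inr hx))
  | pplus p s t hs ht =>
    exact .pplus p (hs fun x hx => h x (.inl hx)) (ht fun x hx => h x (.inr hx))

end EquationalLogic

section TermAlgebra

variable {E : Equations} {X Y Z : Type u}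

/-- Homomorphisms of algebras for the signature. -/
structure Alg.IsHom {α β : Type*} (𝔸 : Alg α) (𝔹 : Alg β) (f : α → β) : Prop where
  map_star : f 𝔸.star = 𝔹.star
  map_oplus (a b : α) : f (𝔸.oplus a b) = 𝔹.oplus (f a) (f b)
  map_pplus (p : Prob) (a b : α) : f (𝔸.pplus p a b) = 𝔹.pplus p (f a) (f b)

theorem Alg.IsHom.comp {α β γ : Type*} {𝔸 : Alg α} {𝔹 : Alg β} {ℬ : Alg γ} {g : β → γ}
    {f : α → β} (hg : 𝔹.IsHom ℬ g) (hf : 𝔸.IsHom 𝔹 f) : 𝔸.IsHom ℬ (g ∘ f) where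
  map_star := by simp only [Function.comp_apply, hf.map_star, hg.map_star]
  map_oplus a b := by simp only [Function.comp_apply, hf.map_oplus, hg.map_oplus]
  map_pplus p a b := by simp only [Function.comp_apply, hf.map_pplus, hg.map_pplus]

theorem Alg.IsHom.map_eval {α β : Type*} {𝔸 : Alg α} {𝔹 : Alg β} {f : α → β}
    (hf : 𝔸.IsHom 𝔹 f) (η : X → α) (t : Term X) : f (t.eval 𝔸 η) = t.eval 𝔹 (f ∘ η) := by
  induction t with
  | var x => rfl
  | star => exact hf.map_star
  | oplus s t hs ht => simp only [Term.eval, hf.map_oplus, hs, ht]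
  | pplus p s t hs ht => simp only [Term.eval, hf.map_pplus, hs, ht]

/-- The equivalence class of a term modulo provable equality in the theory `E`. -/
def TermMod.mk (E : Equations) (t : Term X) : TermMod E X := Quotient.mk _ t

/-- The algebra of terms over `X` modulo provable equality in the theory `E`. -/
def termAlg (E : Equations) (X : Type u) : Alg (TermMod E X) where
  star := TermMod.mk E .star
  oplus := Quotient.map₂ .oplus fun _ _ hs _ _ ht => .oplus hs ht
  pplus p := Quotient.map₂ (.pplus p) fun _ _ hs _ _ ht => .pplus p hs ht

theorem eval_termAlg {V : Type*} (θ : V → Term X) (t : Term V) :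
    t.eval (termAlg E X) (fun v => TermMod.mk E (θ v)) = TermMod.mk E (t.subst θ) := by
  induction t with
  | var x => rfl
  | star => rfl
  | oplus s t hs ht => exact congrArg₂ (termAlg E X).oplus hs ht
  | pplus p s t hs ht => exact congrArg₂ ((termAlg E X).pplus p) hs ht

theorem termAlg_models (E : Equations) (X : Type u) : (termAlg E X).Models E := by
  intro e he η
  obtain ⟨θ, rfl⟩ : ∃ θ : ℕ → Term X, (fun n => TermMod.mk E (θ n)) = η :=
    ⟨fun n => (η n).out, funext fun n => Quotient.out_eq (η n)⟩
  rw [eval_termAlg, eval_termAlg]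
  exact Quotient.sound (.ax he θ)

theorem TermMod.lift_injective {α : Type*} {𝔸 : Alg α} (h : 𝔸.Models E) {ι : X → α}
    {f : α → TermMod E X} (hf : 𝔸.IsHom (termAlg E X) f)
    (hι : ∀ x, f (ι x) = TermMod.mk E (.var x)) :
    Function.Injective (TermMod.lift h ι) := by
  refine Function.LeftInverse.injective (g := f) fun t => ?_
  induction t using Quotient.ind with | _ t
  calc f (t.eval 𝔸 ι) = t.eval (termAlg E X) (f ∘ ι) := hf.map_eval ι t
    _ = t.eval (termAlg E X) (fun x => TermMod.mk E (.var x)) :=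
        congrArg (Term.eval (termAlg E X) · t) (funext hι)
    _ = TermMod.mk E (t.subst .var) := eval_termAlg _ t
    _ = TermMod.mk E t := by rw [t.subst_var]

/-- Renaming of the generators of a term modulo `E`. -/
def TermMod.map (f : X → Y) : TermMod E X → TermMod E Y :=
  Quotient.map (Term.subst fun x => .var (f x)) fun _ _ d => d.subst fun _ _ h => h.elim

theorem TermMod.map_id (t : TermMod E X) : t.map id = t := by
  induction t using Quotient.ind with | _ t
  exact congrArg _ t.subst_var

theorem TermMod.map_map (f : X → Y) (g : Y → Z) (t : TermMod E X) :
    (t.map f).map g = t.map (g ∘ f) := by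
  induction t using Quotient.ind with | _ t
  exact congrArg _ (t.subst_subst _ _)

theorem TermMod.lift_map {α : Type*} {𝔸 : Alg α} (h : 𝔸.Models E) (η : Y → α) (f : X → Y)
    (t : TermMod E X) : lift h η (t.map f) = lift h (η ∘ f) t := by
  induction t using Quotient.ind with | _ t
  exact Term.eval_subst _ _ _ _

theorem Alg.IsHom.map_lift {α β : Type*} {𝔸 : Alg α} {𝔹 : Alg β} {f : α → β}
    (hf : 𝔸.IsHom 𝔹 f) (hA : 𝔸.Models E) (hB : 𝔹.Models E) (η : X → α) (t : TermMod E X) :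
    f (TermMod.lift hA η t) = TermMod.lift hB (f ∘ η) t := by
  induction t using Quotient.ind with | _ t
  exact hf.map_eval η t

/-- The functor `X ↦ TermMod E X`. -/
def termModFunctor (E : Equations) : Type u ⥤ Type u where
  obj := TermMod E
  map f := ↾(TermMod.map f)
  map_id _ := ConcreteCategory.hom_ext _ _ TermMod.map_id
  map_comp f g := ConcreteCategory.hom_ext _ _ fun t => (TermMod.map_map f g t).symm

/-- The evaluation of terms modulo `E` in models of `E` on the values of a functor, with functorial
units `ι`, as a natural transformation. -/
def liftNatTrans {F : Type u ⥤ Type u} {𝔸 : ∀ X, Alg (F.obj X)} (h : ∀ X, (𝔸 X).Models E)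
    (ι : ∀ X, X → F.obj X) (hF : ∀ {X Y : Type u} (f : X ⟶ Y), (𝔸 X).IsHom (𝔸 Y) (F.map f))
    (hι : ∀ {X Y : Type u} (f : X ⟶ Y) (x : X), F.map f (ι X x) = ι Y (f x)) :
    termModFunctor E ⟶ F where
  app X := ↾(TermMod.lift (h X) (ι X))
  naturality X Y f := ConcreteCategory.hom_ext _ _ fun (t : TermMod E X) =>
    calc TermMod.lift (h Y) (ι Y) (TermMod.map f t) = TermMod.lift (h Y) (ι Y ∘ f) t :=
          TermMod.lift_map _ _ _ _
      _ = TermMod.lift (h Y) (F.map f ∘ ι X) t :=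
          congrArg (fun η => TermMod.lift (h Y) η t) (funext fun x => (hι f x).symm)
      _ = F.map f (TermMod.lift (h X) (ι X) t) := ((hF f).map_lift _ _ _ _).symm

end TermAlgebra

/-! ### The proof system and behavioural equivalence -/

section ProofSystem

variable {A : Type u} {E : Equations}

theorem behaviourallyEquivalent_functorOfNatTrans_iff {F G : Type u ⥤ Type u} (σ : F ⟶ G)
    (hσ : ∀ X, Function.Injective (σ.app X)) (V : Endofunctor.Coalgebra F) (x y : V.V) :
    BehaviourallyEquivalent ((Endofunctor.Coalgebra.functorOfNatTrans σ).obj V) x y ↔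
      BehaviourallyEquivalent V x y := by
  have map_app (R : Setoid V.V) (z : V.V) :
      G.map (↾(Quotient.mk R)) (σ.app _ (V.str z)) =
        σ.app _ (F.map (↾(Quotient.mk R)) (V.str z)) :=
    (ConcreteCategory.congr_hom (σ.naturality (↾(Quotient.mk R))) (V.str z)).symm
  refine exists_congr fun R => and_congr_left fun _ => forall₃_congr fun z w _ => ?_
  exact (Eq.congr (map_app R z) (map_app R w)).trans (hσ _).eq_iff

theorem provablyEq_iff_derivable {P Q : Proc A} :
    ProvablyEq E P Q ↔ Derivable E (ProvablyEq E) P.step Q.step :=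
  ⟨fun ⟨_, hR, d⟩ => d.mono hR, .rule _ fun _ _ h => h⟩

/-- Provable equality of process terms as an equivalence relation. -/
def provablyEqSetoid (E : Equations) (A : Type u) : Setoid (Proc A) where
  r := ProvablyEq E
  iseqv :=
    { refl _ := provablyEq_iff_derivable.2 (.refl _)
      symm h := provablyEq_iff_derivable.2 (provablyEq_iff_derivable.1 h).symm
      trans h h' := provablyEq_iff_derivable.2 <|
        (provablyEq_iff_derivable.1 h).trans (provablyEq_iff_derivable.1 h') }

/-- Process terms as a coalgebra for the functor of terms modulo `E`. -/
def procTermMod (E : Equations) (A : Type u) : Endofunctor.Coalgebra (termModFunctor.{u} E) where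
  V := Proc A
  str := ↾fun P => TermMod.mk E P.step

theorem isBehaviouralEquivalence_procTermMod_iff {R : Setoid (Proc A)} :
    IsBehaviouralEquivalence (procTermMod E A) R ↔ ∀ P Q, R P Q →
      Derivable E (fun _ _ => False) (P.step.subst fun P' => .var (Quotient.mk R P'))
        (Q.step.subst fun P' => .var (Quotient.mk R P')) :=
  forall₃_congr fun _ _ _ => Quotient.eq

theorem isBehaviouralEquivalence_provablyEqSetoid :
    IsBehaviouralEquivalence (procTermMod E A) (provablyEqSetoid E A) :=
  isBehaviouralEquivalence_procTermMod_iff.2 fun _ _ h =>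
    (provablyEq_iff_derivable.1 h).subst fun _ _ h' => by rw [Quotient.sound h']; exact .refl _

/-- The nesting depth of the constructors of a process term. -/
def Proc.depth : Proc A → ℕ
  | nil => 0
  | act _ P => P.depth + 1
  | oplus P Q => max P.depth Q.depth
  | pplus _ P Q => max P.depth Q.depth

theorem Proc.depth_lt_of_mem_vars_step {P P' : Proc A} (h : P' ∈ P.step.vars) :
    P'.depth < P.depth := by
  induction P with
  | nil => exact h.elim
  | act a P => exact h ▸ Nat.lt_succ_self _
  | oplus P Q hP hQ => exact lt_max_iff.2 (h.imp hP hQ)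
  | pplus p P Q hP hQ => exact lt_max_iff.2 (h.imp hP hQ)

theorem exists_minimal_representatives {α : Type*} (R : Setoid α) (d : α → ℕ) :
    ∃ rep : Quotient R → α, ∀ x, R x (rep ⟦x⟧) ∧ d (rep ⟦x⟧) ≤ d x := by
  have (q : Quotient R) : ∃ y, ⟦y⟧ = q ∧ ∀ x, ⟦x⟧ = q → d y ≤ d x := by
    obtain ⟨y, hy, hmin⟩ := (measure d).wf.has_min {y | ⟦y⟧ = q} q.exists_rep
    exact ⟨y, hy, fun x hx => not_lt.1 (hmin x hx)⟩
  choose rep hrep hmin using this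
  exact ⟨rep, fun x => ⟨Quotient.exact (hrep ⟦x⟧).symm, hmin _ x rfl⟩⟩

theorem IsBehaviouralEquivalence.provablyEq {R : Setoid (Proc A)}
    (hR : IsBehaviouralEquivalence (procTermMod E A) R) {P Q : Proc A} (h : R P Q) :
    ProvablyEq E P Q := by
  obtain ⟨rep, hrep⟩ := exists_minimal_representatives R Proc.depth
  induction hn : max P.depth Q.depth using Nat.strong_induction_on generalizing P Q with
  | _ n ih
  have step_rep {P : Proc A} (hP : P.depth ≤ n) :
      Derivable E (ProvablyEq E) P.step (P.step.subst fun P' => .var (rep ⟦P'⟧)) := by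
    nth_rw 1 [← P.step.subst_var]
    refine Derivable.subst_congr fun P' hP' => .hyp ?_
    refine ih _ ?_ (hrep P').1 rfl
    rw [max_eq_left (hrep P').2]
    exact (Proc.depth_lt_of_mem_vars_step hP').trans_le hP
  have rep_rep : Derivable E (ProvablyEq E) (P.step.subst fun P' => .var (rep ⟦P'⟧))
      (Q.step.subst fun P' => .var (rep ⟦P'⟧)) := by
    have d := isBehaviouralEquivalence_procTermMod_iff.1 hR P Q h
    have := d.subst (R' := ProvablyEq E) (θ := fun q => .var (rep q)) fun _ _ h => h.elim
    rwa [Term.subst_subst, Term.subst_subst] at this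
  exact provablyEq_iff_derivable.2 <| (step_rep (hn ▸ le_max_left _ _)).trans <|
    rep_rep.trans (step_rep (hn ▸ le_max_right _ _)).symm

theorem provablyEq_iff_behaviourallyEquivalent {P Q : Proc A} :
    ProvablyEq E P Q ↔ BehaviourallyEquivalent (procTermMod E A) P Q :=
  ⟨fun h => ⟨_, isBehaviouralEquivalence_provablyEqSetoid, h⟩,
    fun ⟨_, hR, h⟩ => hR.provablyEq h⟩

theorem provablyEq_iff_of_injective {F : Type u ⥤ Type u} (σ : termModFunctor E ⟶ F)
    (hσ : ∀ X, Function.Injective (σ.app X)) (P Q : Proc A) :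
    ProvablyEq E P Q ↔ BehaviourallyEquivalent
      ((Endofunctor.Coalgebra.functorOfNatTrans σ).obj (procTermMod E A)) P Q :=
  provablyEq_iff_behaviourallyEquivalent.trans
    (behaviourallyEquivalent_functorOfNatTrans_iff σ hσ (procTermMod E A) P Q).symm

end ProofSystem

/-! ### Barycentric algebras -/

/-- Barycentric algebras: mixtures `x +_p y` for `p ∈ (0,1)`, subject to the equations of convex
algebras. -/
class BarycentricAlgebra (α : Type*) where
  mix : Prob → α → α → α
  mix_assoc (p q : Prob) (x y z : α) :
    mix p (mix q x y) z = mix (p.mul q) x (mix (p.skew q) y z)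
  mix_comm (p : Prob) (x y : α) : mix p x y = mix p.compl y x
  mix_self (p : Prob) (x : α) : mix p x x = x

/-- The probability `r / (r + s)`. -/
noncomputable def ratio (r s : {r : ℝ // 0 < r}) : Prob :=
  ⟨r.1 / (r.1 + s.1), div_pos r.2 (add_pos r.2 s.2),
    (div_lt_one (add_pos r.2 s.2)).2 (lt_add_of_pos_right _ s.2)⟩

theorem compl_ratio (r s : {r : ℝ // 0 < r}) : (ratio r s).compl = ratio s r := by
  have h : r.1 + s.1 ≠ 0 := (add_pos r.2 s.2).ne'
  refine Subtype.ext ?_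
  simp only [Prob.compl, ratio]
  rw [one_sub_div h, add_sub_cancel_left, add_comm r.1]

theorem mul_ratio (r s t : {r : ℝ // 0 < r}) :
    (ratio (r + s) t).mul (ratio r s) = ratio r (s + t) := by
  have hr := r.2
  have hs := s.2
  have ht := t.2
  refine Subtype.ext ?_
  simp only [Prob.mul, ratio, Positive.coe_add]
  field_simp
  ring

theorem skew_ratio (r s t : {r : ℝ // 0 < r}) :
    (ratio (r + s) t).skew (ratio r s) = ratio s t := by
  have hr := r.2
  have hs := s.2
  have ht := t.2
  have h : 1 - (r.1 + s.1) / (r.1 + s.1 + t.1) * (r.1 / (r.1 + s.1)) =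
      (s.1 + t.1) / (r.1 + s.1 + t.1) := by
    field_simp
    ring
  refine Subtype.ext ?_
  simp only [Prob.skew, ratio, Positive.coe_add, h]
  field_simp
  ring

theorem ratio_mul_left (p r s : {r : ℝ // 0 < r}) : ratio (p * r) (p * s) = ratio r s := by
  refine Subtype.ext ?_
  simp only [ratio, Positive.val_mul]
  rw [← mul_add, mul_div_mul_left _ _ p.2.ne']

/-- Points of `α` with a positive mass. Together with an apex, added below as the zero of
`WithZero`, they form the cone over `α`, in which convex combinations become sums. -/
@[ext]
structure MassPoint (α : Type*) where
  mass : {r : ℝ // 0 < r}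
  pt : α

namespace MassPoint

/-- The cone over `α`. -/
abbrev Cone (α : Type*) : Type _ := WithZero (MassPoint α)

open Classical in
/-- The point `x` with mass `r`, which is the apex unless `r` is positive. -/
noncomputable def point {α : Type*} (x : α) (r : ℝ) : Cone α :=
  if hr : 0 < r then WithZero.coe ⟨⟨r, hr⟩, x⟩ else 0

theorem point_of_pos {α : Type*} {r : ℝ} (hr : 0 < r) (x : α) :
    point x r = WithZero.coe ⟨⟨r, hr⟩, x⟩ :=
  dif_pos hr

@[simp] theorem point_zero {α : Type*} (x : α) : point x 0 = 0 := dif_neg (lt_irrefl _)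

theorem point_one_injective {α : Type*} : Function.Injective fun x : α => point x 1 := by
  intro x y hxy
  simp only [point_of_pos one_pos, WithZero.coe_inj] at hxy
  exact congrArg pt hxy

variable {α : Type*} [BarycentricAlgebra α]

open BarycentricAlgebra

noncomputable instance : Add (MassPoint α) where
  add a b := ⟨a.mass + b.mass, mix (ratio a.mass b.mass) a.pt b.pt⟩

theorem mass_add (a b : MassPoint α) : (a + b).mass = a.mass + b.mass := rfl

theorem pt_add (a b : MassPoint α) : (a + b).pt = mix (ratio a.mass b.mass) a.pt b.pt := rfl

noncomputable instance : AddCommSemigroup (MassPoint α) where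
  add_assoc a b c := by
    refine MassPoint.ext (add_assoc a.mass b.mass c.mass) ?_
    simp only [pt_add, mass_add]
    rw [mix_assoc, mul_ratio, skew_ratio]
  add_comm a b := by
    refine MassPoint.ext (add_comm a.mass b.mass) ?_
    simp only [pt_add]
    rw [mix_comm, compl_ratio]

theorem point_add {r s : ℝ} (hr : 0 ≤ r) (hs : 0 ≤ s) (x : α) :
    point x (r + s) = point x r + point x s := by
  rcases hr.eq_or_lt with rfl | hr
  · rw [zero_add, point_zero, zero_add]
  rcases hs.eq_or_lt with rfl | hs
  · rw [add_zero, point_zero, add_zero]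
  rw [point_of_pos (add_pos hr hs), point_of_pos hr, point_of_pos hs, ← WithZero.coe_add]
  exact congrArg _ (MassPoint.ext rfl (mix_self _ x).symm)

theorem point_add_point (p : Prob) (x y : α) :
    point x p.1 + point y (1 - p.1) = point (mix p x y) 1 := by
  rw [point_of_pos p.2.1, point_of_pos (sub_pos.2 p.2.2), point_of_pos one_pos, ← WithZero.coe_add]
  refine congrArg _ (MassPoint.ext (Subtype.ext (add_sub_cancel p.1 1)) ?_)
  refine congrArg (mix · x y) (Subtype.ext ?_)
  simp only [ratio, add_sub_cancel, div_one]

/-- The mass of a point of the cone. -/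
noncomputable def massHom : Cone α →+ ℝ :=
  WithZero.lift ⟨fun a => a.mass, fun _ _ => rfl⟩

theorem massHom_point {r : ℝ} (hr : 0 ≤ r) (x : α) : massHom (point x r) = r := by
  rcases hr.eq_or_lt with rfl | hr
  · rw [point_zero, map_zero]
  · rw [point_of_pos hr]
    rfl

theorem exists_eq_point_of_massHom_eq_one {a : Cone α} (ha : massHom a = 1) :
    ∃ x, a = point x 1 := by
  rcases a with _ | a
  · exact absurd ha zero_ne_one
  · refine ⟨a.pt, ?_⟩
    rw [point_of_pos one_pos]
    exact congrArg _ (MassPoint.ext (Subtype.ext ha) rfl)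

/-- Multiplication of masses by a positive number. -/
noncomputable def scale (p : {r : ℝ // 0 < r}) : Cone α →+ Cone α :=
  WithZero.mapAddHom
    { toFun a := ⟨p * a.mass, a.pt⟩
      map_add' a b := MassPoint.ext (mul_add p a.mass b.mass)
        (congrArg (mix · a.pt b.pt) (ratio_mul_left p a.mass b.mass).symm) }

theorem scale_point (p : {r : ℝ // 0 < r}) {r : ℝ} (hr : 0 ≤ r) (x : α) :
    scale p (point x r) = point x (p.1 * r) := by
  rcases hr.eq_or_lt with rfl | hr
  · rw [mul_zero, point_zero, map_zero]
  · rw [point_of_pos hr, point_of_pos (mul_pos p.2 hr)]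
    rfl

/-- The sum of the points of `α`, weighted by the masses `f`. -/
noncomputable def total (f : α →₀ ℝ) : Cone α := f.sum point

theorem total_single (x : α) (r : ℝ) : total (.single x r) = point x r :=
  Finsupp.sum_single_index (point_zero x)

theorem total_add {f g : α →₀ ℝ} (hf : 0 ≤ f) (hg : 0 ≤ g) :
    total (f + g) = total f + total g := by
  classical
  unfold total
  rw [Finsupp.sum_of_support_subset _ Finsupp.support_add _ fun x _ => point_zero x,
    Finsupp.sum_of_support_subset f Finset.subset_union_left _ fun x _ => point_zero x,
    Finsupp.sum_of_support_subset g Finset.subset_union_right _ fun x _ => point_zero x,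
    ← Finset.sum_add_distrib]
  exact Finset.sum_congr rfl fun x _ => point_add (hf x) (hg x) x

theorem total_smul {r : ℝ} (hr : 0 < r) {f : α →₀ ℝ} (hf : 0 ≤ f) :
    total (r • f) = scale ⟨r, hr⟩ (total f) := by
  unfold total
  rw [Finsupp.sum_smul_index point_zero, Finsupp.sum, Finsupp.sum, map_sum]
  exact Finset.sum_congr rfl fun x _ => (scale_point ⟨r, hr⟩ (hf x) x).symm

theorem massHom_total (φ : StdSimplex ℝ α) : massHom (total φ.weights) = 1 := by
  rw [← φ.total, total, Finsupp.sum, Finsupp.sum, map_sum]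
  exact Finset.sum_congr rfl fun x _ => massHom_point (φ.nonneg x) x

end MassPoint

namespace BarycentricAlgebra

open MassPoint

variable {α : Type*} [BarycentricAlgebra α]

theorem exists_total_eq_point (φ : StdSimplex ℝ α) : ∃ x, total φ.weights = point x 1 :=
  exists_eq_point_of_massHom_eq_one (massHom_total φ)

/-- The barycentre of a finitely supported distribution on a barycentric algebra. -/
noncomputable def barycentre (φ : StdSimplex ℝ α) : α := (exists_total_eq_point φ).choose

theorem total_weights (φ : StdSimplex ℝ α) : total φ.weights = point (barycentre φ) 1 :=
  (exists_total_eq_point φ).choose_spec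

theorem barycentre_single (x : α) : barycentre (.single x : StdSimplex ℝ α) = x :=
  point_one_injective <| (total_weights _).symm.trans (total_single x 1)

theorem barycentre_mix (p : Prob) (φ ψ : StdSimplex ℝ α) :
    barycentre (ConvSet.mix p φ ψ) = mix p (barycentre φ) (barycentre ψ) := by
  have hp : 0 < 1 - p.1 := sub_pos.2 p.2.2
  refine point_one_injective ?_
  calc point (barycentre (ConvSet.mix p φ ψ)) 1
    _ = total (p.1 • φ.weights + (1 - p.1) • ψ.weights) := by
      rw [← total_weights, ConvSet.mix, StdSimplex.weights_convexCombPair]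
    _ = total (p.1 • φ.weights) + total ((1 - p.1) • ψ.weights) :=
      total_add (smul_nonneg p.2.1.le φ.nonneg) (smul_nonneg hp.le ψ.nonneg)
    _ = point (barycentre φ) p.1 + point (barycentre ψ) (1 - p.1) := by
      rw [total_smul p.2.1 φ.nonneg, total_smul hp ψ.nonneg, total_weights, total_weights,
        scale_point _ zero_le_one, scale_point _ zero_le_one, mul_one, mul_one]
    _ = point (mix p (barycentre φ) (barycentre ψ)) 1 := point_add_point p _ _

end BarycentricAlgebra

/-! ### Convex semilattices -/

theorem Prob.compl_compl (p : Prob) : p.compl.compl = p := Subtype.ext (sub_sub_cancel 1 p.1)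

namespace ConvSet

variable {X Y : Type u}

theorem exists_generators (S : ConvSet X) :
    ∃ B : Set (StdSimplex ℝ X), B.Finite ∧ B.Nonempty ∧ S.carrier = Convexity.convexHull ℝ B := by
  obtain ⟨B, hB, hS⟩ := S.finitelyGenerated
  exact ⟨B, hB, Convexity.convexHull_nonempty.1 (hS ▸ S.nonempty), hS⟩

theorem map_dirac (f : X → Y) (x : X) : (dirac x).map f = dirac (f x) := by
  apply ConvSet.ext
  simp only [map, dirac, Set.image_singleton, StdSimplex.map_single]

theorem map_union (f : X → Y) (S T : ConvSet X) :
    (S.union T).map f = (S.map f).union (T.map f) := by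
  apply ConvSet.ext
  simp only [map, union, (StdSimplex.isAffineMap_map ℝ f).image_convexHull, Set.image_union]

theorem map_minkowski (f : X → Y) (p : Prob) (S T : ConvSet X) :
    (minkowski p S T).map f = minkowski p (S.map f) (T.map f) :=
  ConvSet.ext <| Set.image_image2_distrib (mix_map (StdSimplex.isAffineMap_map ℝ f) p)

end ConvSet

/-- Convex semilattices: semilattices with mixtures that distribute over binary joins. -/
class ConvexSemilattice (α : Type*) extends SemilatticeSup α, BarycentricAlgebra α where
  mix_sup (p : Prob) (x y z : α) : mix p x (y ⊔ z) = mix p x y ⊔ mix p x z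

namespace ConvexSemilattice

open BarycentricAlgebra

variable {α : Type u} [ConvexSemilattice α] {p : Prob} {x y u : α}

theorem mix_mono_right {y y' : α} (hy : y ≤ y') : mix p x y ≤ mix p x y' := by
  rw [← sup_eq_right, ← mix_sup, sup_eq_right.2 hy]

theorem mix_le (hx : x ≤ u) (hy : y ≤ u) : mix p x y ≤ u :=
  calc mix p x y ≤ mix p x u := mix_mono_right hy
    _ = mix p.compl u x := mix_comm p x u
    _ ≤ mix p.compl u u := mix_mono_right hx
    _ = u := mix_self _ u

theorem mix_le_of_isLUB_right {t : Set α} (ht : t.Finite) (hne : t.Nonempty) (hy : IsLUB t y)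
    (h : ∀ b ∈ t, mix p x b ≤ u) : mix p x y ≤ u := by
  lift t to Finset α using ht
  obtain rfl : y = t.sup' hne id := hy.unique (Finset.isLUB_sup' hne)
  rw [Finset.apply_sup'_eq_sup'_comp hne (mix p x) (mix_sup p x)]
  exact Finset.sup'_le _ _ h

theorem mix_le_of_isLUB_left {s : Set α} (hs : s.Finite) (hne : s.Nonempty) (hx : IsLUB s x)
    (h : ∀ a ∈ s, mix p a y ≤ u) : mix p x y ≤ u := by
  simp only [mix_comm p _ y] at h ⊢
  exact mix_le_of_isLUB_right hs hne hx h

theorem isLUB_image2_mix {s t : Set α} (hs : s.Finite) (ht : t.Finite) (hs' : s.Nonempty)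
    (ht' : t.Nonempty) (hx : IsLUB s x) (hy : IsLUB t y) :
    IsLUB (Set.image2 (mix p) s t) (mix p x y) := by
  refine ⟨?_, fun u hu => ?_⟩
  · rintro _ ⟨a, ha, b, hb, rfl⟩
    calc mix p a b ≤ mix p a y := mix_mono_right (hy.1 hb)
      _ = mix p.compl y a := mix_comm p a y
      _ ≤ mix p.compl y x := mix_mono_right (hx.1 ha)
      _ = mix p x y := by rw [mix_comm, Prob.compl_compl]
  · exact mix_le_of_isLUB_left hs hs' hx fun a ha => mix_le_of_isLUB_right ht ht' hy fun b hb =>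
      hu (Set.mem_image2_of_mem ha hb)

theorem isConvexSet_barycentre_le (u : α) :
    IsConvexSet ℝ {φ : StdSimplex ℝ α | barycentre φ ≤ u} := by
  refine IsConvexSet.of_convexCombPair_mem fun a b ha hb hab φ hφ ψ hψ => ?_
  obtain rfl : b = 1 - a := eq_sub_of_add_eq' hab
  rcases ha.eq_or_lt with rfl | ha'
  · simpa only [sub_zero, convexCombPair_zero] using hψ
  rcases hb.eq_or_lt with hb' | hb'
  · obtain rfl : a = 1 := (sub_eq_zero.1 hb'.symm).symm
    simpa only [sub_self, convexCombPair_one] using hφ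
  exact (barycentre_mix ⟨a, ha', sub_pos.1 hb'⟩ φ ψ).trans_le (mix_le hφ hψ)

theorem isLUB_barycentre_convexHull_iff {B : Set (StdSimplex ℝ α)} :
    IsLUB (barycentre '' Convexity.convexHull ℝ B) x ↔ IsLUB (barycentre '' B) x := by
  refine isLUB_congr (Set.Subset.antisymm ?_ fun u hu => ?_)
  · exact upperBounds_mono_set (Set.image_mono subset_convexHull_self)
  · rw [mem_upperBounds, Set.forall_mem_image] at hu ⊢
    exact convexHull_min hu (isConvexSet_barycentre_le u)

theorem exists_isLUB_barycentre (S : ConvSet α) : ∃ x, IsLUB (barycentre '' S.carrier) x := by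
  obtain ⟨B, hB, hBne, hS⟩ := S.exists_generators
  obtain ⟨s, hs⟩ := (hB.image barycentre).exists_finset_coe
  have hne : s.Nonempty := Finset.coe_nonempty.1 (hs ▸ hBne.image _)
  rw [hS]
  exact ⟨_, isLUB_barycentre_convexHull_iff.2 (hs ▸ Finset.isLUB_sup' hne)⟩

/-- The join of the barycentres of the distributions in a finitely generated convex set. -/
noncomputable def join (S : ConvSet α) : α := (exists_isLUB_barycentre S).choose

theorem isLUB_join (S : ConvSet α) : IsLUB (barycentre '' S.carrier) (join S) :=
  (exists_isLUB_barycentre S).choose_spec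

theorem join_dirac (x : α) : join (.dirac x) = x := by
  refine (isLUB_join _).unique ?_
  rw [ConvSet.dirac, Set.image_singleton, barycentre_single]
  exact isLUB_singleton

theorem join_union (S T : ConvSet α) : join (S.union T) = join S ⊔ join T := by
  refine (isLUB_join _).unique (isLUB_barycentre_convexHull_iff.2 ?_)
  rw [Set.image_union]
  exact (isLUB_join S).union (isLUB_join T)

theorem join_minkowski (p : Prob) (S T : ConvSet α) :
    join (S.minkowski p T) = mix p (join S) (join T) := by
  obtain ⟨B, hB, hBne, hS⟩ := S.exists_generators
  obtain ⟨C, hC, hCne, hT⟩ := T.exists_generators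
  have hST : (S.minkowski p T).carrier =
      Convexity.convexHull ℝ (Set.image2 (ConvSet.mix p) B C) := by
    rw [← ConvSet.image2_mix_convexHull, ← hS, ← hT, ConvSet.minkowski]
  refine (isLUB_join _).unique ?_
  rw [hST, isLUB_barycentre_convexHull_iff, Set.image_image2_distrib (barycentre_mix p)]
  exact isLUB_image2_mix (hB.image _) (hC.image _) (hBne.image _) (hCne.image _)
    (isLUB_barycentre_convexHull_iff.1 (hS ▸ isLUB_join S))
    (isLUB_barycentre_convexHull_iff.1 (hT ▸ isLUB_join T))

end ConvexSemilattice

/-! ### Freeness of the three monads -/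

theorem pointedCS_subset_bottomCS : pointedCS ⊆ bottomCS := Set.subset_union_left

theorem pointedCS_subset_bottomBlackHoleCS : pointedCS ⊆ bottomBlackHoleCS :=
  Set.subset_union_left.trans Set.subset_union_left

section Models

variable {α : Type u} {𝔸 : Alg α} {X : Type u}

theorem Alg.Models.mono {E E' : Equations} (h : 𝔸.Models E) (hE : E' ⊆ E) : 𝔸.Models E' :=
  fun e he => h e (hE he)

theorem Alg.Models.oplus_star (h : 𝔸.Models bottomEq) (x : α) : 𝔸.oplus x 𝔸.star = x :=
  h _ rfl fun _ => x

theorem Alg.Models.pplus_star (h : 𝔸.Models blackHoleEq) (p : Prob) (x : α) :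
    𝔸.pplus p x 𝔸.star = 𝔸.star :=
  h _ ⟨p, rfl⟩ fun _ => x

/-- The valuation of the variables `0`, `1`, `2` by `x`, `y`, `z`. -/
def valuation (x y z : α) : ℕ → α
  | 0 => x
  | 1 => y
  | _ => z

/-- A model of the theory of pointed convex semilattices, as a convex semilattice. -/
abbrev Alg.Models.convexSemilattice (h : 𝔸.Models pointedCS) : ConvexSemilattice α :=
  { @SemilatticeSup.mk' α ⟨𝔸.oplus⟩ (fun x y => h _ .C (valuation x y y))
      (fun x y z => (h _ .A (valuation x y z)).symm) (fun x => h _ .I (valuation x x x)) with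
    mix := 𝔸.pplus
    mix_assoc p q x y z := h _ (.Ap p q) (valuation x y z)
    mix_comm p x y := h _ (.Cp p) (valuation x y y)
    mix_self p x := h _ (.Ip p) (valuation x x x)
    mix_sup p x y z := h _ (.D p) (valuation x y z) }

/-- The join of a finitely generated convex set of distributions on a model of the theory of
pointed convex semilattices. -/
noncomputable def Alg.Models.join (h : 𝔸.Models pointedCS) (S : ConvSet α) : α :=
  letI := h.convexSemilattice
  ConvexSemilattice.join S

theorem Alg.Models.join_dirac (h : 𝔸.Models pointedCS) (x : α) : h.join (.dirac x) = x :=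
  letI := h.convexSemilattice
  ConvexSemilattice.join_dirac x

theorem Alg.Models.join_union (h : 𝔸.Models pointedCS) (S T : ConvSet α) :
    h.join (S.union T) = 𝔸.oplus (h.join S) (h.join T) :=
  letI := h.convexSemilattice
  ConvexSemilattice.join_union S T

theorem Alg.Models.join_minkowski (h : 𝔸.Models pointedCS) (p : Prob) (S T : ConvSet α) :
    h.join (S.minkowski p T) = 𝔸.pplus p (h.join S) (h.join T) :=
  letI := h.convexSemilattice
  ConvexSemilattice.join_minkowski p S T

/-- The homomorphism from `C(X + 1)` to a model of the theory of pointed convex semilattices that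
extends `η`. -/
noncomputable def convPlusOneExtend (h : 𝔸.Models pointedCS) (η : X → α)
    (S : ConvSet (Option X)) : α :=
  h.join (S.map fun o => o.elim 𝔸.star η)

theorem convPlusOneExtend_dirac (h : 𝔸.Models pointedCS) (η : X → α) (o : Option X) :
    convPlusOneExtend h η (.dirac o) = o.elim 𝔸.star η := by
  rw [convPlusOneExtend, ConvSet.map_dirac, h.join_dirac]

theorem isHom_convPlusOneExtend (h : 𝔸.Models pointedCS) (η : X → α) :
    (convPlusOneAlg X).IsHom 𝔸 (convPlusOneExtend h η) where
  map_star := convPlusOneExtend_dirac h η none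
  map_oplus S T := (congrArg h.join (ConvSet.map_union _ S T)).trans (h.join_union _ _)
  map_pplus p S T := (congrArg h.join (ConvSet.map_minkowski _ p S T)).trans
    (h.join_minkowski p _ _)

theorem segment_eq_union (x : X) :
    segment x = (ConvSet.dirac (some x)).union (ConvSet.dirac none) :=
  rfl

theorem convPlusOneExtend_segment (h : 𝔸.Models bottomCS) (η : X → α) (x : X) :
    convPlusOneExtend (h.mono pointedCS_subset_bottomCS) η (segment x) = η x := by
  rw [segment_eq_union]
  refine ((isHom_convPlusOneExtend _ η).map_oplus _ _).trans ?_
  rw [convPlusOneExtend_dirac, convPlusOneExtend_dirac]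
  exact (h.mono Set.subset_union_right).oplus_star (η x)

theorem isHom_convDownAlg_val (X : Type u) :
    (convDownAlg X).IsHom (convPlusOneAlg X) Subtype.val where
  map_star := rfl
  map_oplus _ _ := rfl
  map_pplus _ _ _ := rfl

/-- The extension of `η` to `C(X) + 1`. It is a homomorphism to models of the theory of convex
semilattices with bottom and black hole. -/
noncomputable def plusOneConvExtend (h : 𝔸.Models pointedCS) (η : X → α) :
    Option (ConvSet X) → α
  | none => 𝔸.star
  | some S => h.join (S.map η)

theorem isHom_plusOneConvExtend (h : 𝔸.Models bottomBlackHoleCS) (η : X → α) :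
    (plusOneConvAlg X).IsHom 𝔸
      (plusOneConvExtend (h.mono pointedCS_subset_bottomBlackHoleCS) η) := by
  have hCS : 𝔸.Models pointedCS := h.mono pointedCS_subset_bottomBlackHoleCS
  have oplus_star (x : α) : 𝔸.oplus x 𝔸.star = x :=
    (h.mono (Set.subset_union_right.trans Set.subset_union_left)).oplus_star x
  have star_oplus (x : α) : 𝔸.oplus 𝔸.star x = x :=
    (hCS _ .C (valuation 𝔸.star x x)).trans (oplus_star x)
  have pplus_star (p : Prob) (x : α) : 𝔸.pplus p x 𝔸.star = 𝔸.star :=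
    (h.mono Set.subset_union_right).pplus_star p x
  have star_pplus (p : Prob) (x : α) : 𝔸.pplus p 𝔸.star x = 𝔸.star :=
    (hCS _ (.Cp p) (valuation 𝔸.star x x)).trans (pplus_star _ x)
  refine ⟨rfl, ?_, ?_⟩
  · rintro (_ | S) (_ | T)
    · exact (oplus_star _).symm
    · exact (star_oplus _).symm
    · exact (oplus_star _).symm
    · exact (congrArg hCS.join (ConvSet.map_union η S T)).trans (hCS.join_union _ _)
  · rintro p (_ | S) (_ | T)
    · exact (pplus_star p _).symm
    · exact (star_pplus p _).symm
    · exact (pplus_star p _).symm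
    · exact (congrArg hCS.join (ConvSet.map_minkowski η p S T)).trans (hCS.join_minkowski p _ _)

end Models

section Free

variable (X : Type u)

theorem convPlusOneSigma_injective : Function.Injective (convPlusOneSigma X) :=
  TermMod.lift_injective _ (isHom_convPlusOneExtend (termAlg_models pointedCS X) _) fun x =>
    convPlusOneExtend_dirac _ (fun x => TermMod.mk _ (.var x)) (some x)

theorem convDownSigma_injective : Function.Injective (convDownSigma X) :=
  TermMod.lift_injective _ ((isHom_convPlusOneExtend _ _).comp (isHom_convDownAlg_val X))
    (convPlusOneExtend_segment (termAlg_models bottomCS X) fun x => TermMod.mk _ (.var x))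

theorem plusOneConvSigma_injective : Function.Injective (plusOneConvSigma X) :=
  TermMod.lift_injective _ (isHom_plusOneConvExtend (termAlg_models bottomBlackHoleCS X)
    fun x => TermMod.mk _ (.var x)) fun x =>
      (congrArg _ (ConvSet.map_dirac _ x)).trans (Alg.Models.join_dirac _ _)

end Free

section Naturality

variable {X Y : Type u}

theorem isHom_convPlusOne_map (f : X ⟶ Y) :
    (convPlusOneAlg X).IsHom (convPlusOneAlg Y) (convPlusOne.map f) where
  map_star := ConvSet.map_dirac _ none
  map_oplus := ConvSet.map_union _
  map_pplus := ConvSet.map_minkowski _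

theorem isHom_convDown_map (f : X ⟶ Y) :
    (convDownAlg X).IsHom (convDownAlg Y) (convDown.map f) where
  map_star := Subtype.ext (ConvSet.map_dirac _ none)
  map_oplus S T := Subtype.ext (ConvSet.map_union _ S.1 T.1)
  map_pplus p S T := Subtype.ext (ConvSet.map_minkowski _ p S.1 T.1)

theorem isHom_plusOneConv_map (f : X ⟶ Y) :
    (plusOneConvAlg X).IsHom (plusOneConvAlg Y) (plusOneConv.map f) where
  map_star := rfl
  map_oplus := by
    rintro (_ | S) (_ | T)
    · rfl
    · rfl
    · rfl
    · exact congrArg some (ConvSet.map_union f S T)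
  map_pplus := by
    rintro p (_ | S) (_ | T)
    · rfl
    · rfl
    · rfl
    · exact congrArg some (ConvSet.map_minkowski f p S T)

theorem map_segment (f : X → Y) (x : X) : (segment x).map (Option.map f) = segment (f x) := by
  rw [segment_eq_union, ConvSet.map_union, ConvSet.map_dirac, ConvSet.map_dirac]
  rfl

/-- `convPlusOneSigma` as a natural transformation. -/
noncomputable def convPlusOneNatTrans : termModFunctor.{u} pointedCS ⟶ convPlusOne :=
  liftNatTrans convPlusOneAlg_models (fun _ => convPlusOneUnit) isHom_convPlusOne_map
    fun _ x => ConvSet.map_dirac _ (some x)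

/-- `convDownSigma` as a natural transformation. -/
noncomputable def convDownNatTrans : termModFunctor.{u} bottomCS ⟶ convDown :=
  liftNatTrans convDownAlg_models (fun _ => convDownUnit) isHom_convDown_map
    fun f x => Subtype.ext (map_segment f x)

/-- `plusOneConvSigma` as a natural transformation. -/
noncomputable def plusOneConvNatTrans : termModFunctor.{u} bottomBlackHoleCS ⟶ plusOneConv :=
  liftNatTrans plusOneConvAlg_models (fun _ => plusOneConvUnit) isHom_plusOneConv_map
    fun f x => congrArg some (ConvSet.map_dirac f x)

end Naturality

end NDProb

theorem mainTheorem11 (A : Type u) (P Q : NDProb.Proc A) :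
    (NDProb.ProvablyEq NDProb.pointedCS P Q ↔
      NDProb.BehaviourallyEquivalent (NDProb.procConvPlusOne A) P Q) ∧
    (NDProb.ProvablyEq NDProb.bottomBlackHoleCS P Q ↔
      NDProb.BehaviourallyEquivalent (NDProb.procPlusOneConv A) P Q) ∧
    (NDProb.ProvablyEq NDProb.bottomCS P Q ↔
      NDProb.BehaviourallyEquivalent (NDProb.procConvDown A) P Q) :=
  ⟨NDProb.provablyEq_iff_of_injective NDProb.convPlusOneNatTrans
      NDProb.convPlusOneSigma_injective P Q,
    NDProb.provablyEq_iff_of_injective NDProb.plusOneConvNatTrans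
      NDProb.plusOneConvSigma_injective P Q,
    NDProb.provablyEq_iff_of_injective NDProb.convDownNatTrans
      NDProb.convDownSigma_injective P Q⟩
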